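/- All graphs are finite and simple, without isolated vertices, and are considered up to isomorphism; the empty graph, written $1$, is allowed. A \emph{partially labeled graph} is a graph in which some vertices carry labels from $\mathbb{N}$, each vertex at most one label and distinct vertices distinct labels (isomorphisms preserve labels). Let $\mathcal{A}$ be the $\mathbb{R}$-algebra of formal finite real linear combinations of partially labeled graphs, where the product $H_1H_2$ is obtained from the disjoint union by identifying vertices with the same label and keeping one copy of each doubled edge. Let $\mathcal{A}_\emptyset\subset\mathcal{A}$ be the subalgebra spanned by the unlabeled graphs, whose elements are called \emph{graph combinations}, and let $[[\cdot]]:\mathcal{A}\to\mathcal{A}_\emptyset$ be the linear map that removes all labels. A graph combination is a \emph{sum of squares} (sos) if it is a finite sum $\sum_j [[a_j^2]]$ with $a_j\in\mathcal{A}$, and it is \emph{$d$-sos} if the $a_j$ can be chosen such that all graphs occurring in them have at most $d$ edges. It is a \emph{rational sos} if it equals $c/b$ with $b\neq 0$ and $c$ sos, that is, if $ab=c$ in $\mathcal{A}_\emptyset$ for some sos graph combinations $b\ne 0$ and $c$. For a positive integer $d$ let $\mathcal{V}_d$ be the (finite) set of connected graphs other than $1$ of the form $[[AB]]$, where $A,B$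 are partially labeled graphs with at most $d$ edges each. A graph all of whose connected components lie in $\mathcal{V}_d$ is the product of its components, so a combination $a$ of such graphs is a polynomial in the elements of $\mathcal{V}_d$ and can be evaluated at every $\mathbf{v}\in\mathbb{R}^{\mathcal{V}_d}$; this applies to all $d$-sos graph combinations. The \emph{$d$-sos-profile} is $$\mathcal{S}_d=\{\mathbf{v}\in\mathbb{R}_{\ge 0}^{\mathcal{V}_d} : a(\mathbf{v})\ge 0 \text{ for every } d\text{-sos graph combination } a\}.$$ A graph combination $a$ is \emph{sos-testable} if there is a positive integer $d$ such that all connected components of the graphs occurring in $a$ lie in $\mathcal{V}_d$ and $a(\mathbf{v})\ge 0$ for all $\mathbf{v}\in\mathcal{S}_d$. \textbf{Corollary.} If a graph combination $a\in\mathcal{A}_\emptyset$ is not sos-testable, then it is not a rational sos. -/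

import Mathlib

/-!  # The gluing algebra of partially labeled graphs, sums of squares, and sos-profiles -/

noncomputable section

namespace GluingAlgebra

/-! ## Partially labeled graphs -/

/-- A concrete partially labeled graph without isolated vertices, with labels in `L`: a simple
graph with finitely many edges on the vertex set `L ⊕ ℕ`. Its vertices are the endpoints of its
edges (the support of `graph`); the vertex `Sum.inl l` is the one labeled `l`, and the vertices
`Sum.inr n` are the unlabeled ones. Points of `L ⊕ ℕ` that lie on no edge are not vertices of it. -/
structure PreGraph (L : Type) where
  graph : SimpleGraph (L ⊕ ℕ)
  finite : graph.edgeSet.Finite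

namespace PreGraph

variable {L : Type}

/-- Isomorphism of partially labeled graphs: a graph isomorphism that preserves labels. -/
def Iso (G H : PreGraph L) : Prop :=
  ∃ φ : G.graph ≃g H.graph, ∀ l : L, φ (Sum.inl l) = Sum.inl l

theorem Iso.refl (G : PreGraph L) : G.Iso G := ⟨SimpleGraph.Iso.refl, fun _ => rfl⟩

theorem Iso.symm {G H : PreGraph L} : G.Iso H → H.Iso G := by
  rintro ⟨φ, hφ⟩
  exact ⟨φ.symm, fun l => (congrArg φ.symm (hφ l)).symm.trans (φ.symm_apply_apply _)⟩

theorem Iso.trans {G H K : PreGraph L} : G.Iso H → H.Iso K → G.Iso K := by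
  rintro ⟨φ, hφ⟩ ⟨ψ, hψ⟩
  refine ⟨φ.trans ψ, fun l => ?_⟩
  change ψ (φ _) = _
  rw [hφ, hψ]

instance isoSetoid (L : Type) : Setoid (PreGraph L) where
  r := Iso
  iseqv := ⟨Iso.refl, Iso.symm, Iso.trans⟩

/-- The empty graph, with no vertices. -/
def empty : PreGraph L := ⟨⊥, by simp⟩

/-- Renaming of the unlabeled vertices. -/
def shift (f : ℕ ↪ ℕ) : L ⊕ ℕ ↪ L ⊕ ℕ := (Function.Embedding.refl L).sumMap f

theorem shift_trans (f g : ℕ ↪ ℕ) :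
    (shift g : L ⊕ ℕ → L ⊕ ℕ) ∘ (shift f : L ⊕ ℕ → L ⊕ ℕ) = shift (f.trans g) := by
  funext x
  cases x <;> rfl

/-- The embedding `n ↦ 2 * n`. -/
def evens : ℕ ↪ ℕ := Function.Embedding.inl.trans Equiv.natSumNatEquivNat.toEmbedding

/-- The embedding `n ↦ 2 * n + 1`. -/
def odds : ℕ ↪ ℕ := Function.Embedding.inr.trans Equiv.natSumNatEquivNat.toEmbedding

theorem evens_apply (n : ℕ) : evens n = 2 * n := by simp [evens]

theorem odds_apply (n : ℕ) : odds n = 2 * n + 1 := by simp [odds]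

theorem finite_map {V W : Type} (f : V ↪ W) {G : SimpleGraph V} (h : G.edgeSet.Finite) :
    (G.map f).edgeSet.Finite := by
  rw [SimpleGraph.edgeSet_map]
  exact h.image _

/-- The product of two partially labeled graphs: make the sets of unlabeled vertices disjoint,
then identify vertices with the same label and keep one copy of every edge. -/
def glue (G H : PreGraph L) : PreGraph L where
  graph := G.graph.map (shift evens) ⊔ H.graph.map (shift odds)
  finite := by
    rw [SimpleGraph.edgeSet_sup]
    exact (finite_map _ G.finite).union (finite_map _ H.finite)

/-- The number of edges. -/
def numEdges (G : PreGraph L) : ℕ := G.graph.edgeSet.ncard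

/-- Any two vertices are joined by a path. -/
def Connected (G : PreGraph L) : Prop :=
  ∀ u ∈ G.graph.support, ∀ v ∈ G.graph.support, G.graph.Reachable u v

theorem finite_support (G : PreGraph L) : G.graph.support.Finite := by
  have h : G.graph.support ⊆ ⋃ e ∈ G.graph.edgeSet, {v | v ∈ e} := by
    rintro u ⟨v, huv⟩
    simp only [Set.mem_iUnion]
    exact ⟨s(u, v), huv, by simp⟩
  refine Set.Finite.subset (G.finite.biUnion fun e _ => ?_) h
  induction e with
  | h x y =>
    refine (Set.toFinite {x, y}).subset fun v hv => ?_
    simpa using hv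

/-- The connected component of the vertex `u`. -/
def componentAt (G : PreGraph L) (u : L ⊕ ℕ) : PreGraph L where
  graph :=
    { Adj := fun a b => G.graph.Adj a b ∧ G.graph.Reachable u a
      symm := ⟨fun _ _ h => ⟨h.1.symm, h.2.trans h.1.reachable⟩⟩
      loopless := ⟨fun a h => G.graph.loopless.irrefl a h.1⟩ }
  finite := G.finite.subset fun e => by
    induction e with
    | h x y => exact fun h => h.1

open Classical in
/-- The finite set of the connected components of `G`, as subgraphs of `G`. -/
def componentSet (G : PreGraph L) : Finset (PreGraph L) :=
  G.finite_support.toFinset.image G.componentAt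

/-- Removing all labels: the labeled vertices become unlabeled ones, different from the vertices
that were unlabeled before. -/
def unlabel (G : PreGraph ℕ) : PreGraph Empty where
  graph := G.graph.map
    (Equiv.natSumNatEquivNat.toEmbedding.trans (Function.Embedding.inr : ℕ ↪ Empty ⊕ ℕ))
  finite := finite_map _ G.finite

/-! ### Compatibility with isomorphism -/

theorem iso_of_map {G H : PreGraph L} (σ : Equiv.Perm ℕ)
    (h : G.graph.map (shift (L := L) σ.toEmbedding) = H.graph) : G.Iso H := by
  have e : (shift (L := L) σ.toEmbedding : L ⊕ ℕ → L ⊕ ℕ)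
      = (Equiv.sumCongr (Equiv.refl L) σ : L ⊕ ℕ → L ⊕ ℕ) := by
    funext x
    cases x <;> rfl
  obtain ⟨H, hH⟩ := H
  simp only at h
  subst h
  exact ⟨⟨Equiv.sumCongr (Equiv.refl L) σ, fun {_ _} => by
    simp only [← e, SimpleGraph.map_adj_apply]⟩, fun _ => rfl⟩

theorem exists_map_of_iso {G H : PreGraph L} (h : G.Iso H) :
    ∃ σ : Equiv.Perm ℕ, G.graph.map (shift (L := L) σ.toEmbedding) = H.graph := by
  obtain ⟨φ, hφ⟩ := h
  have hφ' : ∀ l : L, φ.symm (Sum.inl l) = Sum.inl l := fun l =>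
    (congrArg φ.symm (hφ l)).symm.trans (φ.symm_apply_apply _)
  have key : ∀ n : ℕ, ∃ m : ℕ, φ (Sum.inr n) = Sum.inr m := by
    intro n
    rcases hx : φ (Sum.inr n) with l | m
    · have := hφ' l
      rw [← hx, φ.symm_apply_apply] at this
      exact absurd (this.trans hx) (by simp)
    · exact ⟨m, rfl⟩
  have key' : ∀ n : ℕ, ∃ m : ℕ, φ.symm (Sum.inr n) = Sum.inr m := by
    intro n
    rcases hx : φ.symm (Sum.inr n) with l | m
    · have := hφ l
      rw [← hx, φ.apply_symm_apply] at this
      exact absurd (this.trans hx) (by simp)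
    · exact ⟨m, rfl⟩
  choose f hf using key
  choose g hg using key'
  have hgf : ∀ n, g (f n) = n := fun n => by
    have := hg (f n)
    rw [← hf n, φ.symm_apply_apply] at this
    exact (Sum.inr_injective this).symm
  have hfg : ∀ n, f (g n) = n := fun n => by
    have := hf (g n)
    rw [← hg n, φ.apply_symm_apply] at this
    exact (Sum.inr_injective this).symm
  have hs : ∀ x, (shift (L := L) (Equiv.mk f g hgf hfg).toEmbedding) x = φ x := by
    rintro (l | n)
    · exact (hφ l).symm
    · exact (hf n).symm
  refine ⟨⟨f, g, hgf, hfg⟩, ?_⟩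
  ext a b
  rw [SimpleGraph.map_adj]
  constructor
  · rintro ⟨x, y, hxy, rfl, rfl⟩
    rw [hs, hs]
    exact φ.map_adj_iff.2 hxy
  · intro hab
    refine ⟨φ.symm a, φ.symm b, φ.symm.map_adj_iff.2 hab, ?_, ?_⟩
    · rw [hs, φ.apply_symm_apply]
    · rw [hs, φ.apply_symm_apply]

theorem map_sup' {V W : Type} (f : V ↪ W) (G H : SimpleGraph V) :
    (G ⊔ H).map f = G.map f ⊔ H.map f := by
  ext a b
  simp only [SimpleGraph.map_adj, SimpleGraph.sup_adj]
  constructor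
  · rintro ⟨x, y, h | h, rfl, rfl⟩
    · exact Or.inl ⟨x, y, h, rfl, rfl⟩
    · exact Or.inr ⟨x, y, h, rfl, rfl⟩
  · rintro (⟨x, y, h, rfl, rfl⟩ | ⟨x, y, h, rfl, rfl⟩)
    · exact ⟨x, y, Or.inl h, rfl, rfl⟩
    · exact ⟨x, y, Or.inr h, rfl, rfl⟩

/-- Acting on the even and on the odd numbers by two permutations. -/
def permSum (σ τ : Equiv.Perm ℕ) : Equiv.Perm ℕ :=
  Equiv.natSumNatEquivNat.symm.trans ((Equiv.sumCongr σ τ).trans Equiv.natSumNatEquivNat)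

theorem glue_congr {G G' H H' : PreGraph L} (hG : G.Iso G') (hH : H.Iso H') :
    (G.glue H).Iso (G'.glue H') := by
  obtain ⟨σ, hσ⟩ := exists_map_of_iso hG
  obtain ⟨τ, hτ⟩ := exists_map_of_iso hH
  refine iso_of_map (permSum σ τ) ?_
  simp only [glue, ← hσ, ← hτ, map_sup', SimpleGraph.map_map, shift_trans]
  congr 4 <;> ext n <;>
    simp [permSum, evens, odds, -Equiv.natSumNatEquivNat_apply,
      -Equiv.natSumNatEquivNat_symm_apply]

theorem glue_comm (G H : PreGraph L) : (G.glue H).Iso (H.glue G) := by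
  refine iso_of_map (Equiv.natSumNatEquivNat.symm.trans
    ((Equiv.sumComm ℕ ℕ).trans Equiv.natSumNatEquivNat)) ?_
  simp only [glue, map_sup', SimpleGraph.map_map, shift_trans]
  rw [sup_comm]
  congr 4 <;> ext n <;>
    simp [evens, odds, -Equiv.natSumNatEquivNat_apply,
      -Equiv.natSumNatEquivNat_symm_apply]

theorem glue_assoc (G H K : PreGraph L) : ((G.glue H).glue K).Iso (G.glue (H.glue K)) := by
  let e := Equiv.natSumNatEquivNat
  let σ : Equiv.Perm ℕ := e.symm.trans ((Equiv.sumCongr e.symm (Equiv.refl ℕ)).trans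
    ((Equiv.sumAssoc ℕ ℕ ℕ).trans ((Equiv.sumCongr (Equiv.refl ℕ) e).trans e)))
  have h1 : (evens.trans evens).trans σ.toEmbedding = evens := by
    ext n
    simp [σ, e, evens, -Equiv.natSumNatEquivNat_apply, -Equiv.natSumNatEquivNat_symm_apply]
  have h2 : (odds.trans evens).trans σ.toEmbedding = evens.trans odds := by
    ext n
    simp [σ, e, evens, odds, -Equiv.natSumNatEquivNat_apply, -Equiv.natSumNatEquivNat_symm_apply]
  have h3 : odds.trans σ.toEmbedding = odds.trans odds := by
    ext n
    simp [σ, e, odds, -Equiv.natSumNatEquivNat_apply, -Equiv.natSumNatEquivNat_symm_apply]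
  refine iso_of_map σ ?_
  simp only [glue, map_sup', SimpleGraph.map_map, shift_trans]
  rw [sup_assoc, h1, h2, h3]

theorem exists_perm_extending (S : Set ℕ) (hS : S.Finite) (f : ℕ ↪ ℕ) :
    ∃ σ : Equiv.Perm ℕ, ∀ n ∈ S, σ n = f n := by
  classical
  have h1 : Infinite (Sᶜ : Set ℕ) := hS.infinite_compl.to_subtype
  have h2 : Infinite ((f '' S)ᶜ : Set ℕ) := (hS.image f).infinite_compl.to_subtype
  obtain ⟨e⟩ : Nonempty ((Sᶜ : Set ℕ) ≃ ((f '' S)ᶜ : Set ℕ)) := nonempty_equiv_of_countable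
  refine ⟨(Equiv.Set.sumCompl S).symm.trans
    ((Equiv.sumCongr (Equiv.Set.image f S f.injective) e).trans
      (Equiv.Set.sumCompl (f '' S))), fun n hn => ?_⟩
  simp [Equiv.Set.sumCompl_symm_apply_of_mem hn]

theorem iso_map_shift (G : PreGraph L) (f : ℕ ↪ ℕ) :
    G.Iso ⟨G.graph.map (shift f), finite_map _ G.finite⟩ := by
  obtain ⟨σ, hσ⟩ := exists_perm_extending (Sum.inr ⁻¹' G.graph.support)
    (G.finite_support.preimage Sum.inr_injective.injOn) f
  have h : ∀ x ∈ G.graph.support, shift (L := L) σ.toEmbedding x = shift f x := by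
    rintro (l | n) hx
    · rfl
    · exact congrArg Sum.inr (hσ n hx)
  refine iso_of_map σ ?_
  ext a b
  simp only [SimpleGraph.map_adj]
  constructor
  · rintro ⟨x, y, hxy, rfl, rfl⟩
    exact ⟨x, y, hxy, (h x ⟨y, hxy⟩).symm, (h y ⟨x, hxy.symm⟩).symm⟩
  · rintro ⟨x, y, hxy, rfl, rfl⟩
    exact ⟨x, y, hxy, h x ⟨y, hxy⟩, h y ⟨x, hxy.symm⟩⟩

theorem glue_empty (G : PreGraph L) : (G.glue empty).Iso G := by
  refine Iso.symm (Iso.trans (iso_map_shift G evens) ?_)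
  have h : (⟨G.graph.map (shift evens), finite_map _ G.finite⟩ : PreGraph L) = G.glue empty := by
    simp only [glue, empty, mk.injEq]
    ext a b
    simp
  rw [h]
  exact Iso.refl _

theorem numEdges_congr {G H : PreGraph L} (h : G.Iso H) : G.numEdges = H.numEdges := by
  obtain ⟨φ, -⟩ := h
  exact Nat.card_congr φ.mapEdgeSet

theorem Iso.mem_support {G H : PreGraph L} (φ : G.graph ≃g H.graph) (u : L ⊕ ℕ) :
    φ u ∈ H.graph.support ↔ u ∈ G.graph.support := by
  constructor
  · rintro ⟨v, hv⟩
    refine ⟨φ.symm v, ?_⟩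
    change G.graph.Adj u (φ.symm v)
    rw [← φ.map_adj_iff, φ.apply_symm_apply]
    exact hv
  · rintro ⟨v, hv⟩
    exact ⟨φ v, φ.map_adj_iff.2 hv⟩

theorem connected_of_iso {G H : PreGraph L} (h : G.Iso H) (hG : G.Connected) : H.Connected := by
  obtain ⟨φ, -⟩ := h
  intro u hu v hv
  rw [← φ.apply_symm_apply u] at hu ⊢
  rw [← φ.apply_symm_apply v] at hv ⊢
  rw [Iso.mem_support] at hu hv
  exact φ.reachable_iff.2 (hG _ hu _ hv)

theorem unlabel_congr {G H : PreGraph ℕ} (h : G.Iso H) : G.unlabel.Iso H.unlabel := by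
  obtain ⟨σ, hσ⟩ := exists_map_of_iso h
  refine iso_of_map (permSum (Equiv.refl ℕ) σ) ?_
  simp only [unlabel, ← hσ, SimpleGraph.map_map]
  congr 1
  funext x
  rcases x with l | n <;>
    simp [shift, permSum, -Equiv.natSumNatEquivNat_apply,
      -Equiv.natSumNatEquivNat_symm_apply]

end PreGraph

/-! ## Isomorphism classes -/

/-- Partially labeled graphs with labels in `L` and without isolated vertices, up to
isomorphism. -/
def LGraph (L : Type) : Type := Quotient (PreGraph.isoSetoid L)

/-- Partially labeled graphs, with labels in `ℕ`. -/
abbrev PLGraph : Type := LGraph ℕ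

/-- Unlabeled graphs. -/
abbrev UGraph : Type := LGraph Empty

namespace LGraph

variable {L : Type}

/-- The isomorphism class of a graph. -/
def mk (G : PreGraph L) : LGraph L := Quotient.mk _ G

/-- The commutative monoid of partially labeled graphs under gluing; the empty graph is `1`. On
unlabeled graphs the product is the disjoint union. -/
instance : CommMonoid (LGraph L) where
  mul := Quotient.map₂ PreGraph.glue fun _ _ h _ _ h' => PreGraph.glue_congr h h'
  one := mk PreGraph.empty
  mul_assoc := by
    rintro ⟨G⟩ ⟨H⟩ ⟨K⟩
    exact Quotient.sound (PreGraph.glue_assoc G H K)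
  mul_comm := by
    rintro ⟨G⟩ ⟨H⟩
    exact Quotient.sound (PreGraph.glue_comm G H)
  mul_one := by
    rintro ⟨G⟩
    exact Quotient.sound (PreGraph.glue_empty G)
  one_mul := by
    rintro ⟨G⟩
    exact Quotient.sound ((PreGraph.glue_comm _ _).trans (PreGraph.glue_empty G))

/-- The number of edges. -/
def numEdges : LGraph L → ℕ :=
  Quotient.lift PreGraph.numEdges fun _ _ h => PreGraph.numEdges_congr h

/-- Connectedness (the empty graph satisfies it as well). -/
def Connected : LGraph L → Prop :=
  Quotient.lift PreGraph.Connected fun _ _ h =>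
    propext ⟨PreGraph.connected_of_iso h, PreGraph.connected_of_iso (PreGraph.Iso.symm h)⟩

/-- The multiset of (isomorphism classes of) connected components. -/
def components : LGraph L → Multiset (LGraph L) :=
  Quotient.lift (fun G => G.componentSet.val.map mk) fun G H h => by
    classical
    obtain ⟨φ, hφ⟩ := h
    -- transport of components along `φ`
    let T : PreGraph L → PreGraph L := fun C =>
      ⟨C.graph.map φ.toEquiv.toEmbedding, PreGraph.finite_map _ C.finite⟩
    have hT : Function.Injective T := by
      rintro ⟨C, hC⟩ ⟨D, hD⟩ hCD
      simp only [T, PreGraph.mk.injEq] at hCD ⊢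
      exact SimpleGraph.map_injective _ hCD
    have hTiso : ∀ C, mk (T C) = mk C := fun C => by
      refine Quotient.sound (PreGraph.Iso.symm ⟨⟨φ.toEquiv, fun {a b} => ?_⟩, hφ⟩)
      exact SimpleGraph.map_adj_apply (f := φ.toEquiv.toEmbedding)
    have hTc : ∀ u, T (G.componentAt u) = H.componentAt (φ u) := fun u => by
      simp only [T, PreGraph.componentAt, PreGraph.mk.injEq]
      ext a b
      rw [SimpleGraph.map_adj]
      constructor
      · rintro ⟨x, y, ⟨h1, h2⟩, rfl, rfl⟩
        exact ⟨φ.map_adj_iff.2 h1, φ.reachable_iff.2 h2⟩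
      · rintro ⟨h1, h2⟩
        refine ⟨φ.symm a, φ.symm b, ⟨φ.symm.map_adj_iff.2 h1, ?_⟩,
          φ.apply_symm_apply a, φ.apply_symm_apply b⟩
        rw [← φ.reachable_iff, φ.apply_symm_apply]
        exact h2
    have hset : H.componentSet = G.componentSet.map ⟨T, hT⟩ := by
      ext C
      simp only [PreGraph.componentSet, Finset.mem_image, Finset.mem_map, Set.Finite.mem_toFinset,
        Function.Embedding.coeFn_mk]
      constructor
      · rintro ⟨u, hu, rfl⟩
        refine ⟨_, ⟨φ.symm u, ?_, rfl⟩, ?_⟩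
        · rw [← PreGraph.Iso.mem_support φ, φ.apply_symm_apply]
          exact hu
        · rw [hTc, φ.apply_symm_apply]
      · rintro ⟨_, ⟨u, hu, rfl⟩, rfl⟩
        exact ⟨φ u, (PreGraph.Iso.mem_support φ u).2 hu, (hTc u).symm⟩
    change _ = H.componentSet.val.map mk
    rw [hset, Finset.map_val, Multiset.map_map]
    exact Multiset.map_congr rfl fun C _ => (hTiso C).symm

/-- Removing all labels. -/
def unlabel : PLGraph → UGraph :=
  Quotient.map PreGraph.unlabel fun _ _ h => PreGraph.unlabel_congr h

end LGraph

/-! ## Graph combinations and sums of squares -/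

/-- The gluing algebra: formal finite real linear combinations of partially labeled graphs. -/
abbrev LabeledCombination : Type := MonoidAlgebra ℝ PLGraph

/-- Unlabeled graph combinations: formal finite real linear combinations of unlabeled graphs. -/
abbrev GraphCombination : Type := MonoidAlgebra ℝ UGraph

/-- The linear map that removes the labels. -/
def unlabel : LabeledCombination →ₗ[ℝ] GraphCombination :=
  MonoidAlgebra.mapDomainLinearMap ℝ ℝ LGraph.unlabel

/-- Sums of squares: finite sums `∑ [[f i ^ 2]]`. -/
def IsSos (a : GraphCombination) : Prop :=
  ∃ (n : ℕ) (f : Fin n → LabeledCombination), a = ∑ i, unlabel (f i ^ 2)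

/-- `d`-sos graph combinations: sums of squares `∑ [[f i ^ 2]]` in which every constituent graph
of every `f i` has at most `d` edges. -/
def IsDSos (d : ℕ) (a : GraphCombination) : Prop :=
  ∃ (n : ℕ) (f : Fin n → LabeledCombination),
    (∀ i, ∀ F ∈ (f i).coeff.support, F.numEdges ≤ d) ∧ a = ∑ i, unlabel (f i ^ 2)

/-- `a` is a rational sum of squares `c / b`, where `b ≠ 0` and `c` are sums of squares. -/
def IsRationalSos (a : GraphCombination) : Prop :=
  ∃ b c : GraphCombination, b ≠ 0 ∧ IsSos b ∧ IsSos c ∧ a * b = c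

/-! ## Sos-profiles -/

/-- The connected graphs, other than the empty graph, of the form `[[A B]]` with partially labeled
graphs `A`, `B` that have at most `d` edges each. -/
def profileGraphs (d : ℕ) : Set UGraph :=
  {H | H.Connected ∧ ∃ A B : PLGraph, A.numEdges ≤ d ∧ B.numEdges ≤ d ∧
    H = LGraph.unlabel (A * B)} \ {1}

/-- All connected components of the constituent graphs of `a` lie in `profileGraphs d`, that is,
`a` is a polynomial in these graphs. -/
def HasComponentsIn (d : ℕ) (a : GraphCombination) : Prop :=
  ∀ H ∈ a.coeff.support, ∀ C ∈ H.components, C ∈ profileGraphs d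

/-- The value of the graph combination `a` at a point `v`: every constituent graph is the product
of its connected components, and a component `C` is replaced by the coordinate `v C`. This is
meant for `a` with `HasComponentsIn d a`, which includes every `d`-sos graph combination; other
components are given the value `0`. -/
def evalAt {d : ℕ} (v : profileGraphs d → ℝ) (a : GraphCombination) : ℝ :=
  a.coeff.sum fun H α => α * (H.components.map (Function.extend Subtype.val v 0)).prod

/-- The `d`-sos-profile: the nonnegative points at which all `d`-sos graph combinations are
nonnegative. -/
def sosProfile (d : ℕ) : Set (profileGraphs d → ℝ) :=
  {v | (∀ C, 0 ≤ v C) ∧ ∀ a : GraphCombination, IsDSos d a → 0 ≤ evalAt v a}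

/-- `a` is sos-testable: for some positive integer `d`, it is a polynomial in the coordinates of
the `d`-sos-profile and is nonnegative on it. -/
def IsSosTestable (a : GraphCombination) : Prop :=
  ∃ d : ℕ, 0 < d ∧ HasComponentsIn d a ∧ ∀ v ∈ sosProfile d, 0 ≤ evalAt v a

end GluingAlgebra

end

noncomputable section

namespace GluingAlgebra

/-! ## Isomorphism classes of graphs on finite types -/

section FiniteTypes

variable {X Y L : Type}

/-! Let `a * b = c` with `b ≠ 0` and `b`, `c` sos, and take `d` so large that `b`, `c` are `d`-sos
and the graphs in `a` have at most `d` edges. A point of the `d`-sos-profile extends to a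
multiplicative functional `φ` on unlabeled graphs, nonnegative on `d`-sos combinations, and `φ(a)
φ(b) = φ(c)`. This gives `φ(a) ≥ 0` unless `φ(b) = 0`, so `φ` is perturbed.

Color the vertices of a graph independently: `none` with probability `1 - t`, and `w` with
probability `t * q w`, where `w` is a vertex of a fixed graph `K`. Keep the colorings that are
homomorphisms to the disjoint union of `K` and a looped vertex `none`, and average `φ` of the
subgraph colored `none`. This mixture `φ_t` is again multiplicative. It also stays positive
(`IsPositiveUpTo.mixture`): once the colors of the labeled vertices are fixed, the two factors of a
square are colored independently, which leaves a square of combinations with no more edges.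

The value of `φ_t` at a combination is a polynomial in `t`, `φ_0 = φ`, and `φ_1` is the homomorphism
density into `K`. Some density does not vanish at `b` (`exists_lift_mixture_ne_zero`), so `φ_t(b)`
is a nonzero polynomial, nonnegative on `[0, 1]`. Hence `φ_t(a) ≥ 0` for all but finitely many `t`
in `[0, 1]`, and `t → 0` gives `φ(a) ≥ 0` (`IsPositiveUpTo.lift_nonneg_of_mul_eq`). -/

theorem exists_perm_comp_eq [Finite X] (g g' : X ↪ ℕ) :
    ∃ τ : Equiv.Perm ℕ, ∀ x, τ (g x) = g' x := by
  classical
  have h1 : Infinite ((Set.range g)ᶜ : Set ℕ) := (Set.finite_range g).infinite_compl.to_subtype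
  have h2 : Infinite ((Set.range g')ᶜ : Set ℕ) := (Set.finite_range g').infinite_compl.to_subtype
  obtain ⟨e⟩ : Nonempty (((Set.range g)ᶜ : Set ℕ) ≃ ((Set.range g')ᶜ : Set ℕ)) :=
    nonempty_equiv_of_countable
  refine ⟨(Equiv.Set.sumCompl (Set.range g)).symm.trans
    ((Equiv.sumCongr ((Equiv.ofInjective g g.injective).symm.trans
      (Equiv.ofInjective g' g'.injective)) e).trans
      (Equiv.Set.sumCompl (Set.range g'))), fun x => ?_⟩
  rw [Equiv.trans_apply, Equiv.Set.sumCompl_symm_apply_of_mem (Set.mem_range_self x)]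
  have : (Equiv.ofInjective g g.injective).symm ⟨g x, Set.mem_range_self x⟩ = x :=
    Equiv.ofInjective_symm_apply g.injective x
  simp [this]

/-- The graph `G` placed on `L ⊕ ℕ` by an embedding. -/
def ofEmbedding [Finite X] (G : SimpleGraph X) (f : X ↪ L ⊕ ℕ) : PreGraph L :=
  ⟨G.map f, PreGraph.finite_map f (Set.toFinite _)⟩

theorem exists_embedding_emptySum (X : Type) [Finite X] : Nonempty (X ↪ Empty ⊕ ℕ) := by
  obtain ⟨f, hf⟩ := exists_injective_nat X
  exact ⟨⟨fun x => Sum.inr (f x), Sum.inr_injective.comp hf⟩⟩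

theorem ofEmbedding_iso [Finite X] (G : SimpleGraph X) (f g : X ↪ Empty ⊕ ℕ) :
    (ofEmbedding G f).Iso (ofEmbedding G g) := by
  let e : Empty ⊕ ℕ ≃ ℕ := Equiv.emptySum Empty ℕ
  obtain ⟨τ, hτ⟩ := exists_perm_comp_eq (f.trans e.toEmbedding) (g.trans e.toEmbedding)
  refine PreGraph.iso_of_map τ ?_
  simp only [ofEmbedding, SimpleGraph.map_map]
  congr 1
  funext x
  have h := hτ x
  rcases hf : f x with a | n
  · exact a.elim
  rcases hg : g x with a | m
  · exact a.elim
  simp only [Function.Embedding.trans_apply, hf, hg, Equiv.coe_toEmbedding, e,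
    Equiv.emptySum_apply_inr] at h
  simp [PreGraph.shift, hf, h]

/-- The isomorphism class of a graph on a finite type, with the isolated vertices dropped. -/
def cls [Finite X] (G : SimpleGraph X) : UGraph :=
  LGraph.mk (ofEmbedding G (exists_embedding_emptySum X).some)

theorem mk_ofEmbedding [Finite X] (G : SimpleGraph X) (f : X ↪ Empty ⊕ ℕ) :
    LGraph.mk (ofEmbedding G f) = cls G :=
  Quotient.sound (ofEmbedding_iso G f _)

theorem mk_eq_cls [Finite X] (A : PreGraph Empty) (G : SimpleGraph X) (f : X ↪ Empty ⊕ ℕ)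
    (h : A.graph = G.map f) : LGraph.mk A = cls G := by
  rw [← mk_ofEmbedding G f]
  obtain ⟨A, hA⟩ := A
  simp only at h
  subst h
  rfl

theorem cls_map [Finite X] [Finite Y] (G : SimpleGraph X) (f : X ↪ Y) :
    cls (G.map f) = cls G := by
  refine mk_eq_cls _ G (f.trans (exists_embedding_emptySum Y).some) ?_
  simp [ofEmbedding]
  rfl

theorem cls_bot [Finite X] : cls (⊥ : SimpleGraph X) = 1 := by
  symm
  refine mk_eq_cls PreGraph.empty ⊥ (exists_embedding_emptySum X).some ?_
  ext a b
  simp [PreGraph.empty]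

/-- Since `cls` ignores isolated vertices, `X` and `Y` may differ in size; a common finite vertex
set replaces an isomorphism. Any quantity unchanged by `map` along embeddings therefore depends only
on the class. -/
theorem exists_map_eq_of_cls_eq [Finite X] [Finite Y] {G : SimpleGraph X} {H : SimpleGraph Y}
    (h : cls G = cls H) :
    ∃ (Z : Finset (Empty ⊕ ℕ)) (f : X ↪ Z) (g : Y ↪ Z), G.map f = H.map g := by
  classical
  have := Fintype.ofFinite X
  have := Fintype.ofFinite Y
  obtain ⟨τ, hτ⟩ := PreGraph.exists_map_of_iso (Quotient.exact h)
  set f := (exists_embedding_emptySum X).some.trans (PreGraph.shift (L := Empty) τ.toEmbedding)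
    with hf
  set g := (exists_embedding_emptySum Y).some with hg
  have hfg : G.map f = H.map g := by
    rw [ofEmbedding, ofEmbedding, SimpleGraph.map_map] at hτ
    exact hτ
  let Z : Finset (Empty ⊕ ℕ) := Finset.univ.map f ∪ Finset.univ.map g
  let f' : X ↪ Z := ⟨fun x => ⟨f x, by simp [Z]⟩, fun x y hxy => f.injective (by simpa using hxy)⟩
  let g' : Y ↪ Z := ⟨fun x => ⟨g x, by simp [Z]⟩, fun x y hxy => g.injective (by simpa using hxy)⟩
  refine ⟨Z, f', g', SimpleGraph.map_injective (Function.Embedding.subtype _) ?_⟩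
  rw [SimpleGraph.map_map, SimpleGraph.map_map]
  exact hfg

theorem exists_cls_eq (H : UGraph) :
    ∃ (n : ℕ) (G : SimpleGraph (Fin n)), cls G = H ∧ ∀ x, ∃ y, G.Adj x y := by
  obtain ⟨A⟩ := H
  have hfin : Finite A.graph.support := A.finite_support
  obtain ⟨n, ⟨e⟩⟩ := Finite.exists_equiv_fin A.graph.support
  let f : Fin n ↪ Empty ⊕ ℕ := e.symm.toEmbedding.trans (Function.Embedding.subtype _)
  have hf : ∀ a ∈ A.graph.support, ∃ x, f x = a := fun a ha => ⟨e ⟨a, ha⟩, by simp [f]⟩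
  refine ⟨n, A.graph.comap f, (mk_eq_cls A _ f ?_).symm, fun x => ?_⟩
  · ext a b
    rw [SimpleGraph.map_adj]
    constructor
    · intro h
      obtain ⟨x, rfl⟩ := hf a ⟨b, h⟩
      obtain ⟨y, rfl⟩ := hf b ⟨_, h.symm⟩
      exact ⟨x, y, h, rfl, rfl⟩
    · rintro ⟨x, y, h, rfl, rfl⟩
      exact h
  · obtain ⟨b, hb⟩ : f x ∈ A.graph.support := (e.symm x).2
    obtain ⟨y, rfl⟩ := hf b ⟨_, hb.symm⟩
    exact ⟨y, hb⟩

theorem cls_mul [Finite X] [Finite Y] (G : SimpleGraph X) (H : SimpleGraph Y) :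
    cls G * cls H = cls (G.map (Sum.inl : X → X ⊕ Y) ⊔ H.map (Sum.inr : Y → X ⊕ Y)) := by
  let f := (exists_embedding_emptySum X).some
  let g := (exists_embedding_emptySum Y).some
  have hfg : Function.Injective (Sum.elim
      ((PreGraph.shift (L := Empty) PreGraph.evens : _ → _) ∘ f)
      ((PreGraph.shift (L := Empty) PreGraph.odds : _ → _) ∘ g)) := by
    refine Function.Injective.sumElim ((PreGraph.shift _).injective.comp f.injective)
      ((PreGraph.shift _).injective.comp g.injective) fun x y => ?_
    rcases hf : f x with a | n
    · exact a.elim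
    rcases hg : g y with a | m
    · exact a.elim
    change PreGraph.shift _ (f x) ≠ PreGraph.shift _ (g y)
    rw [hf, hg]
    intro h
    have h' : PreGraph.evens n = PreGraph.odds m := Sum.inr_injective h
    rw [PreGraph.evens_apply, PreGraph.odds_apply] at h'
    omega
  refine mk_eq_cls ((ofEmbedding G f).glue (ofEmbedding H g)) _ ⟨_, hfg⟩ ?_
  have := PreGraph.map_sup' (⟨_, hfg⟩ : X ⊕ Y ↪ Empty ⊕ ℕ) (G.map (Sum.inl : X → X ⊕ Y))
    (H.map (Sum.inr : Y → X ⊕ Y))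
  refine Eq.trans ?_ this.symm
  simp only [PreGraph.glue, ofEmbedding, SimpleGraph.map_map]
  rfl

/-! ## Partially labeled graphs on finite types -/

variable {m N : ℕ}

/-- The natural embedding of `Fin m ⊕ Fin N`. -/
def finSumEmbedding (m N : ℕ) : Fin m ⊕ Fin N ↪ ℕ ⊕ ℕ :=
  Fin.valEmbedding.sumMap Fin.valEmbedding

/-- The isomorphism class of a partially labeled graph, in which the vertices of `Fin m` are
labeled and those of `Fin N` are unlabeled. -/
def labeledCls (G : SimpleGraph (Fin m ⊕ Fin N)) : PLGraph :=
  LGraph.mk (ofEmbedding G (finSumEmbedding m N))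

/-- A common `m` lets all graphs of one combination share the same spaces of colorings. -/
theorem exists_labeledCls_eq (S : Finset PLGraph) :
    ∃ m : ℕ, ∀ A ∈ S, ∃ G : SimpleGraph (Fin m ⊕ Fin m), labeledCls G = A := by
  have key : ∀ A : PLGraph, ∃ m : ℕ, ∀ k ≥ m, ∃ G : SimpleGraph (Fin k ⊕ Fin k),
      labeledCls G = A := by
    rintro ⟨A⟩
    obtain ⟨m, hm⟩ := (A.finite_support.image (Sum.elim id id : ℕ ⊕ ℕ → ℕ)).bddAbove
    refine ⟨m + 1, fun k hk => ⟨A.graph.comap (finSumEmbedding k k), ?_⟩⟩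
    have hf : ∀ a ∈ A.graph.support, ∃ x, finSumEmbedding k k x = a := by
      intro a ha
      have := hm ⟨a, ha, rfl⟩
      rcases a with a | a
      · exact ⟨Sum.inl ⟨a, by simp at this; omega⟩, rfl⟩
      · exact ⟨Sum.inr ⟨a, by simp at this; omega⟩, rfl⟩
    have h : (A.graph.comap (finSumEmbedding k k)).map (finSumEmbedding k k) = A.graph := by
      ext a b
      rw [SimpleGraph.map_adj]
      constructor
      · rintro ⟨x, y, h, rfl, rfl⟩
        exact h
      · intro h
        obtain ⟨x, rfl⟩ := hf a ⟨b, h⟩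
        obtain ⟨y, rfl⟩ := hf b ⟨_, h.symm⟩
        exact ⟨x, y, h, rfl, rfl⟩
    obtain ⟨A, hA⟩ := A
    simp only [labeledCls, ofEmbedding] at h ⊢
    simp only [h]
    rfl
  choose m hm using key
  exact ⟨S.sup m, fun A hA => hm A _ (Finset.le_sup hA)⟩

theorem numEdges_labeledCls (G : SimpleGraph (Fin m ⊕ Fin N)) :
    (labeledCls G).numEdges = G.edgeSet.ncard := by
  change (G.map (finSumEmbedding m N)).edgeSet.ncard = _
  rw [SimpleGraph.edgeSet_map, Set.ncard_image_of_injective _ (Function.Embedding.injective _)]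

/-- The first copy in the amalgam of two copies of `X ⊕ Y` over `X`. -/
def amalgLeft (X Y : Type) : X ⊕ Y ↪ X ⊕ (Y ⊕ Y) :=
  (Function.Embedding.refl X).sumMap Function.Embedding.inl

/-- The second copy in the amalgam of two copies of `X ⊕ Y` over `X`. -/
def amalgRight (X Y : Type) : X ⊕ Y ↪ X ⊕ (Y ⊕ Y) :=
  (Function.Embedding.refl X).sumMap Function.Embedding.inr

/-- Gluing shares the labeled part and duplicates the unlabeled one. This splitting is what makes
the two factors independent once the labeled vertices are colored. -/
theorem unlabel_labeledCls_mul (G H : SimpleGraph (Fin m ⊕ Fin N)) :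
    (labeledCls G * labeledCls H).unlabel
      = cls (G.map (amalgLeft (Fin m) (Fin N)) ⊔ H.map (amalgRight (Fin m) (Fin N))) := by
  let f : Fin m ⊕ (Fin N ⊕ Fin N) → ℕ ⊕ ℕ :=
    Sum.elim (fun i => Sum.inl i) (Sum.elim (fun j => Sum.inr (PreGraph.evens j))
      fun j => Sum.inr (PreGraph.odds j))
  have hf : Function.Injective f := by
    rintro (i | i | i) (j | j | j) h <;>
      simp [f, PreGraph.evens_apply, PreGraph.odds_apply, Fin.ext_iff] at h ⊢ <;> omega
  let u : ℕ ⊕ ℕ ↪ Empty ⊕ ℕ :=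
    Equiv.natSumNatEquivNat.toEmbedding.trans (Function.Embedding.inr : ℕ ↪ Empty ⊕ ℕ)
  refine mk_eq_cls ((PreGraph.glue (ofEmbedding G (finSumEmbedding m N))
    (ofEmbedding H (finSumEmbedding m N))).unlabel) _ ((⟨f, hf⟩ : _ ↪ _).trans u) ?_
  rw [PreGraph.map_sup']
  simp only [PreGraph.unlabel, PreGraph.glue, ofEmbedding]
  rw [PreGraph.map_sup']
  simp only [SimpleGraph.map_map]
  congr 2 <;> funext x <;> rcases x with x | x <;> rfl

end FiniteTypes

/-! ## Connected components -/

section Components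

/-- No edge leaves the image of `f`, so a path starting there pulls back to `G` edge by edge. -/
theorem exists_of_reachable_sup_map {U V W : Type} {G : SimpleGraph U} {H : SimpleGraph V}
    {f : U ↪ W} {g : V ↪ W} (hfg : ∀ x y, f x ≠ g y) {u : U} {w : W}
    (h : (G.map f ⊔ H.map g).Reachable (f u) w) : ∃ x, f x = w ∧ G.Reachable u x := by
  rw [SimpleGraph.reachable_iff_reflTransGen] at h
  induction h with
  | refl => exact ⟨u, rfl, SimpleGraph.Reachable.refl _⟩
  | tail _ hab ih =>
    obtain ⟨x, rfl, hx⟩ := ih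
    rw [SimpleGraph.sup_adj, SimpleGraph.map_adj, SimpleGraph.map_adj] at hab
    rcases hab with ⟨a, b, hab, ha, rfl⟩ | ⟨a, b, hab, ha, rfl⟩
    · obtain rfl := f.injective ha
      exact ⟨b, rfl, hx.trans hab.reachable⟩
    · exact absurd ha.symm (hfg _ _)

/-- Renaming of the vertices of an unlabeled graph. -/
def rename (f : Empty ⊕ ℕ ↪ Empty ⊕ ℕ) (C : PreGraph Empty) : PreGraph Empty :=
  ⟨C.graph.map f, PreGraph.finite_map f C.finite⟩

theorem rename_injective (f : Empty ⊕ ℕ ↪ Empty ⊕ ℕ) : Function.Injective (rename f) := by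
  rintro ⟨C, hC⟩ ⟨D, hD⟩ h
  simp only [rename, PreGraph.mk.injEq] at h ⊢
  exact SimpleGraph.map_injective f h

theorem mk_rename_shift (f : ℕ ↪ ℕ) (C : PreGraph Empty) :
    LGraph.mk (rename (PreGraph.shift f) C) = LGraph.mk C :=
  Quotient.sound (PreGraph.Iso.symm (PreGraph.iso_map_shift C f))

theorem componentAt_eq_rename {K G H : PreGraph Empty} {f g : Empty ⊕ ℕ ↪ Empty ⊕ ℕ}
    (hfg : ∀ x y, f x ≠ g y) (hK : K.graph = G.graph.map f ⊔ H.graph.map g) (u : Empty ⊕ ℕ) :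
    K.componentAt (f u) = rename f (G.componentAt u) := by
  simp only [PreGraph.componentAt, rename, PreGraph.mk.injEq]
  ext a b
  rw [SimpleGraph.map_adj]
  constructor
  · rintro ⟨h1, h2⟩
    rw [hK] at h1 h2
    obtain ⟨x, rfl, hx⟩ := exists_of_reachable_sup_map hfg h2
    rw [SimpleGraph.sup_adj, SimpleGraph.map_adj, SimpleGraph.map_adj] at h1
    rcases h1 with ⟨a, b, hab, ha, rfl⟩ | ⟨a, b, hab, ha, rfl⟩
    · obtain rfl := f.injective ha
      exact ⟨a, b, ⟨hab, hx⟩, rfl, rfl⟩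
    · exact absurd ha.symm (hfg _ _)
  · rintro ⟨x, y, ⟨h1, h2⟩, rfl, rfl⟩
    have hle : G.graph.map f ≤ K.graph := hK ▸ le_sup_left
    refine ⟨hle (SimpleGraph.map_adj_apply.2 h1), ?_⟩
    have : (G.graph.map f).Reachable (f u) (f x) :=
      h2.map ⟨f, fun h => SimpleGraph.map_adj_apply.2 h⟩
    exact this.mono hle

theorem shift_evens_ne_shift_odds (x y : Empty ⊕ ℕ) :
    PreGraph.shift PreGraph.evens x ≠ PreGraph.shift PreGraph.odds y := by
  rcases x with a | n
  · exact a.elim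
  rcases y with a | m
  · exact a.elim
  intro h
  have h' : PreGraph.evens n = PreGraph.odds m := Sum.inr_injective h
  rw [PreGraph.evens_apply, PreGraph.odds_apply] at h'
  omega

theorem mem_componentSet {L : Type} {G C : PreGraph L} :
    C ∈ G.componentSet ↔ ∃ u ∈ G.graph.support, G.componentAt u = C := by
  simp [PreGraph.componentSet]

open Classical in
theorem componentSet_glue (G H : PreGraph Empty) :
    (G.glue H).componentSet
      = G.componentSet.map ⟨rename (PreGraph.shift PreGraph.evens), rename_injective _⟩
        ∪ H.componentSet.map ⟨rename (PreGraph.shift PreGraph.odds), rename_injective _⟩ := by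
  have hl := componentAt_eq_rename (K := G.glue H) shift_evens_ne_shift_odds rfl
  have hr := componentAt_eq_rename (K := G.glue H)
    (fun x y => (shift_evens_ne_shift_odds y x).symm) (sup_comm _ _)
  have hs : (G.glue H).graph.support
      = PreGraph.shift PreGraph.evens '' G.graph.support
        ∪ PreGraph.shift PreGraph.odds '' H.graph.support := by
    rw [← SimpleGraph.support_map, ← SimpleGraph.support_map]
    ext a
    simp only [SimpleGraph.mem_support, PreGraph.glue, SimpleGraph.sup_adj, exists_or,
      Set.mem_union]
  ext C
  simp only [Finset.mem_union, Finset.mem_map, mem_componentSet, hs, Set.mem_union,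
    Function.Embedding.coeFn_mk]
  constructor
  · rintro ⟨_, ⟨u, hu, rfl⟩ | ⟨u, hu, rfl⟩, rfl⟩
    · exact Or.inl ⟨_, ⟨u, hu, rfl⟩, (hl u).symm⟩
    · exact Or.inr ⟨_, ⟨u, hu, rfl⟩, (hr u).symm⟩
  · rintro (⟨_, ⟨u, hu, rfl⟩, rfl⟩ | ⟨_, ⟨u, hu, rfl⟩, rfl⟩)
    · exact ⟨_, Or.inl ⟨u, hu, rfl⟩, hl u⟩
    · exact ⟨_, Or.inr ⟨u, hu, rfl⟩, hr u⟩

theorem components_mul (G H : UGraph) : (G * H).components = G.components + H.components := by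
  classical
  obtain ⟨G⟩ := G
  obtain ⟨H⟩ := H
  change (G.glue H).componentSet.val.map LGraph.mk
    = G.componentSet.val.map LGraph.mk + H.componentSet.val.map LGraph.mk
  rw [componentSet_glue, ← Finset.disjUnion_eq_union, Finset.disjUnion_val, Multiset.map_add,
    Finset.map_val, Finset.map_val, Multiset.map_map, Multiset.map_map]
  · congr 1 <;> exact Multiset.map_congr rfl fun C _ => mk_rename_shift _ C
  · rw [Finset.disjoint_left]
    simp only [Finset.mem_map, mem_componentSet, Function.Embedding.coeFn_mk]
    -- A component contains an edge, so one common to both sides would have a vertex that is both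
    -- even and odd.
    rintro _ ⟨_, ⟨u, ⟨v, huv⟩, rfl⟩, rfl⟩ ⟨_, ⟨w, -, rfl⟩, h⟩
    have hadj : (rename (PreGraph.shift PreGraph.evens) (G.componentAt u)).graph.Adj
        (PreGraph.shift PreGraph.evens u) (PreGraph.shift PreGraph.evens v) :=
      SimpleGraph.map_adj_apply.2 ⟨huv, SimpleGraph.Reachable.refl _⟩
    rw [← h] at hadj
    obtain ⟨x, y, -, hx, -⟩ := (SimpleGraph.map_adj _ _ _ _).1 hadj
    exact shift_evens_ne_shift_odds _ _ hx.symm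

theorem components_one : (1 : UGraph).components = 0 := by
  -- From `1 * 1 = 1`, the multiset of components equals its own double.
  have h := components_mul 1 1
  rw [mul_one] at h
  simpa using h

/-- The multiplicative extension of a function on connected graphs. -/
def multiplicativeExtension (v : UGraph → ℝ) : UGraph →* ℝ where
  toFun H := (H.components.map v).prod
  map_one' := by simp [components_one]
  map_mul' G H := by simp [components_mul]

/-- Evaluation becomes an algebra homomorphism on all graph combinations, so it can be applied to `a
* b = c` whatever components occur there. -/
theorem evalAt_eq_lift {d : ℕ} (v : profileGraphs d → ℝ) (a : GraphCombination) :
    evalAt v a = MonoidAlgebra.lift ℝ ℝ UGraph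
      (multiplicativeExtension (Function.extend Subtype.val v 0)) a := by
  rw [MonoidAlgebra.lift_apply]
  rfl

theorem exists_unlabel_eq (C : UGraph) :
    ∃ A : PLGraph, A.numEdges = C.numEdges ∧ A.unlabel = C := by
  obtain ⟨C⟩ := C
  let f : Empty ⊕ ℕ ↪ ℕ ⊕ ℕ :=
    (Equiv.emptySum Empty ℕ).toEmbedding.trans Function.Embedding.inr
  refine ⟨LGraph.mk ⟨C.graph.map f, PreGraph.finite_map f C.finite⟩, ?_, ?_⟩
  · change (C.graph.map f).edgeSet.ncard = C.graph.edgeSet.ncard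
    rw [SimpleGraph.edgeSet_map, Set.ncard_image_of_injective _ (Function.Embedding.injective _)]
  -- `unlabel` sends the unlabeled vertex `n` to `2 * n + 1`, so the outcome is literally the `odds`
  -- renaming of `C`.
  · rw [← show LGraph.mk C = Quot.mk _ C from rfl, ← mk_rename_shift PreGraph.odds C]
    change LGraph.mk _ = LGraph.mk _
    congr 1
    simp only [PreGraph.unlabel, rename, SimpleGraph.map_map]
    congr 2
    funext x
    rcases x with a | n
    · exact a.elim
    · rfl

theorem numEdges_one {L : Type} : (1 : LGraph L).numEdges = 0 := by
  change (⊥ : SimpleGraph (L ⊕ ℕ)).edgeSet.ncard = 0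
  simp

theorem connected_componentAt {L : Type} (G : PreGraph L) (u : L ⊕ ℕ) :
    (G.componentAt u).Connected := by
  have key : ∀ a, G.graph.Reachable u a → (G.componentAt u).graph.Reachable u a := by
    intro a h
    rw [SimpleGraph.reachable_iff_reflTransGen] at h
    induction h with
    | refl => exact SimpleGraph.Reachable.refl _
    | tail hub hbc ih =>
      refine ih.trans (SimpleGraph.Adj.reachable ⟨hbc, ?_⟩)
      rwa [SimpleGraph.reachable_iff_reflTransGen]
  rintro a ⟨a', ha⟩ b ⟨b', hb⟩
  exact (key a ha.2).symm.trans (key b hb.2)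

/-- The component has at most `d` edges, so it is `[[A * 1]]` with `A` an unlabeled copy of it;
having an edge, it is not `1`. -/
theorem mem_profileGraphs_of_mem_components {H C : UGraph} (hC : C ∈ H.components) {d : ℕ}
    (hd : H.numEdges ≤ d) : C ∈ profileGraphs d := by
  obtain ⟨G⟩ := H
  change C ∈ G.componentSet.val.map LGraph.mk at hC
  rw [Multiset.mem_map] at hC
  obtain ⟨_, hC, rfl⟩ := hC
  obtain ⟨u, ⟨v, huv⟩, rfl⟩ := mem_componentSet.1 hC
  have hsub : (G.componentAt u).graph.edgeSet ⊆ G.graph.edgeSet := by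
    intro e
    induction e with
    | h x y => exact fun h => h.1
  have hle : (LGraph.mk (G.componentAt u)).numEdges ≤ d :=
    (Set.ncard_le_ncard hsub G.finite).trans hd
  have hne : (LGraph.mk (G.componentAt u)).numEdges ≠ 0 := by
    change (G.componentAt u).graph.edgeSet.ncard ≠ 0
    have hmem : s(u, v) ∈ (G.componentAt u).graph.edgeSet :=
      show (G.componentAt u).graph.Adj u v from ⟨huv, SimpleGraph.Reachable.refl _⟩
    exact (Set.ncard_pos (G.componentAt u).finite).2 ⟨_, hmem⟩ |>.ne'
  obtain ⟨A, hA, hAC⟩ := exists_unlabel_eq (LGraph.mk (G.componentAt u))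
  refine ⟨⟨connected_componentAt G u, A, 1, hA.trans_le hle, ?_, ?_⟩, ?_⟩
  · rw [numEdges_one]
    exact Nat.zero_le d
  · rw [mul_one, hAC]
  · intro h
    rw [Set.mem_singleton_iff] at h
    exact hne (h ▸ numEdges_one)

end Components

/-! ## Independent random colorings of the vertices -/

section Expectation

variable {X Y V : Type} [Fintype X] [Fintype Y] [Fintype V]

open Classical in
/-- The expectation of `F` at a random map `X → V` with independent values of distribution `p`. -/
def expectation (p : V → ℝ) (F : (X → V) → ℝ) : ℝ := ∑ σ : X → V, (∏ x, p (σ x)) * F σ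

theorem expectation_eq_sum [DecidableEq X] (p : V → ℝ) (F : (X → V) → ℝ) :
    expectation p F = ∑ σ : X → V, (∏ x, p (σ x)) * F σ := by
  unfold expectation
  congr!

theorem expectation_equiv (p : V → ℝ) (e : X ≃ Y) (F : (X → V) → ℝ) :
    expectation p (fun τ : Y → V => F (τ ∘ e)) = expectation p F := by
  classical
  unfold expectation
  refine Fintype.sum_equiv (e.symm.arrowCongr (Equiv.refl V)) _ _ fun τ => ?_
  have h : (e.symm.arrowCongr (Equiv.refl V)) τ = τ ∘ e := by
    funext x
    simp [Equiv.arrowCongr]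
  rw [h]
  congr 1
  exact (Fintype.prod_equiv e _ _ fun x => rfl).symm

theorem expectation_sum (p : V → ℝ) (F : (X ⊕ Y → V) → ℝ) :
    expectation p F = expectation p fun σ => expectation p fun τ => F (Sum.elim σ τ) := by
  classical
  simp only [expectation_eq_sum]
  refine (Fintype.sum_equiv (Equiv.sumArrowEquivProdArrow X Y V) _
    (fun στ => (∏ x, p (Sum.elim στ.1 στ.2 x)) * F (Sum.elim στ.1 στ.2)) fun τ => ?_).trans ?_
  · have : Sum.elim ((Equiv.sumArrowEquivProdArrow X Y V) τ).1
        ((Equiv.sumArrowEquivProdArrow X Y V) τ).2 = τ :=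
      (Equiv.sumArrowEquivProdArrow X Y V).symm_apply_apply τ
    rw [this]
  rw [Fintype.sum_prod_type]
  refine Finset.sum_congr rfl fun σ _ => ?_
  rw [Finset.mul_sum]
  refine Finset.sum_congr rfl fun τ _ => ?_
  rw [Fintype.prod_sum_type]
  simp [mul_assoc]

theorem expectation_const {p : V → ℝ} (hp : ∑ v, p v = 1) (c : ℝ) :
    expectation (X := X) p (fun _ => c) = c := by
  classical
  unfold expectation
  rw [← Finset.sum_mul, ← Fintype.piFinset_univ, ← Finset.prod_univ_sum]
  simp [hp]

/-- The coordinates outside the range of `f` are summed out with total mass `1`. -/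
theorem expectation_embedding {p : V → ℝ} (hp : ∑ v, p v = 1) (f : X ↪ Y) (F : (X → V) → ℝ) :
    expectation p (fun τ : Y → V => F (τ ∘ f)) = expectation p F := by
  classical
  let e : X ⊕ ((Set.range f)ᶜ : Set Y) ≃ Y :=
    (Equiv.sumCongr (Equiv.ofInjective f f.injective) (Equiv.refl _)).trans
      (Equiv.Set.sumCompl (Set.range f))
  have he : ∀ x, e (Sum.inl x) = f x := fun x => rfl
  have h := expectation_equiv p e (fun τ => F (τ ∘ Sum.inl))
  have h' : (fun τ : Y → V => F ((τ ∘ e) ∘ Sum.inl)) = fun τ : Y → V => F (τ ∘ f) := rfl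
  rw [← h', h, expectation_sum]
  simp only [Sum.elim_comp_inl, expectation_const hp]

theorem expectation_mul (p : V → ℝ) (F : (X → V) → ℝ) (F' : (Y → V) → ℝ) :
    expectation p (fun σ => expectation p fun τ => F σ * F' τ)
      = expectation p F * expectation p F' := by
  unfold expectation
  rw [Finset.sum_mul]
  refine Finset.sum_congr rfl fun σ _ => ?_
  rw [mul_assoc, Finset.mul_sum, Finset.mul_sum, Finset.mul_sum]
  exact Finset.sum_congr rfl fun τ _ => by ring

end Expectation

/-! ## Mixing a multiplicative functional with homomorphism densities -/

section Mixing

variable {X Y W : Type}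

/-- The coloring `σ` maps every edge either to `none` at both ends, or to an edge of `K`. -/
def IsAdmissible (K : SimpleGraph W) (G : SimpleGraph X) (σ : X → Option W) : Prop :=
  ∀ x y, G.Adj x y →
    (σ x = none ∧ σ y = none) ∨ ∃ a b, σ x = some a ∧ σ y = some b ∧ K.Adj a b

/-- The graph of all edges of `G` whose ends are both mapped to `none`. -/
def residual (G : SimpleGraph X) (σ : X → Option W) : SimpleGraph X where
  Adj x y := G.Adj x y ∧ σ x = none ∧ σ y = none
  symm := ⟨fun _ _ h => ⟨h.1.symm, h.2.2, h.2.1⟩⟩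
  loopless := ⟨fun _ h => h.1.ne rfl⟩

theorem residual_le (G : SimpleGraph X) (σ : X → Option W) : residual G σ ≤ G :=
  fun _ _ h => h.1

theorem residual_map (G : SimpleGraph X) (f : X ↪ Y) (τ : Y → Option W) :
    residual (G.map f) τ = (residual G (τ ∘ f)).map f := by
  ext a b
  simp only [residual, SimpleGraph.map_adj]
  constructor
  · rintro ⟨⟨x, y, h, rfl, rfl⟩, h1, h2⟩
    exact ⟨x, y, ⟨h, h1, h2⟩, rfl, rfl⟩
  · rintro ⟨x, y, ⟨h, h1, h2⟩, rfl, rfl⟩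
    exact ⟨⟨x, y, h, rfl, rfl⟩, h1, h2⟩

theorem residual_sup (G H : SimpleGraph X) (τ : X → Option W) :
    residual (G ⊔ H) τ = residual G τ ⊔ residual H τ := by
  ext a b
  simp only [residual, SimpleGraph.sup_adj]
  tauto

theorem isAdmissible_map {K : SimpleGraph W} {G : SimpleGraph X} {f : X ↪ Y}
    {τ : Y → Option W} : IsAdmissible K (G.map f) τ ↔ IsAdmissible K G (τ ∘ f) := by
  constructor
  · exact fun h x y hxy => h (f x) (f y) (SimpleGraph.map_adj_apply.2 hxy)
  · intro h a b hab
    obtain ⟨x, y, hxy, rfl, rfl⟩ := (SimpleGraph.map_adj _ _ _ _).1 hab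
    exact h x y hxy

theorem isAdmissible_sup {K : SimpleGraph W} {G H : SimpleGraph X} {τ : X → Option W} :
    IsAdmissible K (G ⊔ H) τ ↔ IsAdmissible K G τ ∧ IsAdmissible K H τ := by
  simp only [IsAdmissible, SimpleGraph.sup_adj]
  constructor
  · exact fun h => ⟨fun x y hxy => h x y (Or.inl hxy), fun x y hxy => h x y (Or.inr hxy)⟩
  · rintro ⟨h1, h2⟩ x y (h | h)
    · exact h1 x y h
    · exact h2 x y h

open Classical in
/-- The indicator function of admissible colorings. -/
def admissibility (K : SimpleGraph W) (G : SimpleGraph X) (σ : X → Option W) : ℝ :=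
  if IsAdmissible K G σ then 1 else 0

theorem admissibility_map (K : SimpleGraph W) (G : SimpleGraph X) (f : X ↪ Y)
    (τ : Y → Option W) : admissibility K (G.map f) τ = admissibility K G (τ ∘ f) := by
  classical exact if_congr isAdmissible_map rfl rfl

theorem admissibility_sup (K : SimpleGraph W) (G H : SimpleGraph X) (τ : X → Option W) :
    admissibility K (G ⊔ H) τ = admissibility K G τ * admissibility K H τ := by
  classical
  simp only [admissibility, isAdmissible_sup]
  split_ifs <;> simp_all

variable [Fintype X] [Fintype Y] [Fintype W]
  (K : SimpleGraph W) (p : Option W → ℝ) (φ : UGraph → ℝ)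

/-- The expected value of `φ` at the residual graph, restricted to admissible colorings. -/
def mixedValue (G : SimpleGraph X) : ℝ :=
  expectation p fun σ => admissibility K G σ * φ (cls (residual G σ))

variable {p}

theorem mixedValue_map (hp : ∑ v, p v = 1) (G : SimpleGraph X) (f : X ↪ Y) :
    mixedValue K p φ (G.map f) = mixedValue K p φ G := by
  unfold mixedValue
  rw [← expectation_embedding hp f]
  simp only [residual_map, cls_map, admissibility_map]

theorem mixedValue_congr (hp : ∑ v, p v = 1) {G : SimpleGraph X} {H : SimpleGraph Y}
    (h : cls G = cls H) : mixedValue K p φ G = mixedValue K p φ H := by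
  obtain ⟨Z, f, g, hfg⟩ := exists_map_eq_of_cls_eq h
  rw [← mixedValue_map K φ hp G f, hfg, mixedValue_map K φ hp]

/-- The two parts of a disjoint union are colored independently, and for fixed colors both the
indicator and `φ` of the residual graph factor. -/
theorem mixedValue_mul (φ : UGraph →* ℝ) (G : SimpleGraph X) (H : SimpleGraph Y) :
    mixedValue K p φ (G.map (Sum.inl : X → X ⊕ Y) ⊔ H.map (Sum.inr : Y → X ⊕ Y))
      = mixedValue K p φ G * mixedValue K p φ H := by
  unfold mixedValue
  rw [expectation_sum, ← expectation_mul]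
  congr 1
  funext σ
  congr 1
  funext τ
  have h1 : residual (G.map (Sum.inl : X → X ⊕ Y)) (Sum.elim σ τ)
      = (residual G σ).map (Sum.inl : X → X ⊕ Y) := residual_map G Function.Embedding.inl _
  have h2 : residual (H.map (Sum.inr : Y → X ⊕ Y)) (Sum.elim σ τ)
      = (residual H τ).map (Sum.inr : Y → X ⊕ Y) := residual_map H Function.Embedding.inr _
  have h3 : admissibility K (G.map (Sum.inl : X → X ⊕ Y)) (Sum.elim σ τ)
      = admissibility K G σ := admissibility_map K G Function.Embedding.inl _
  have h4 : admissibility K (H.map (Sum.inr : Y → X ⊕ Y)) (Sum.elim σ τ)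
      = admissibility K H τ := admissibility_map K H Function.Embedding.inr _
  rw [residual_sup, admissibility_sup, h1, h2, h3, h4, ← cls_mul, map_mul]
  ring

/-- The multiplicative functional obtained from `φ` and the homomorphism densities into `K`. -/
def mixture (hp : ∑ v, p v = 1) (φ : UGraph →* ℝ) : UGraph →* ℝ where
  toFun H := mixedValue K p φ (exists_cls_eq H).choose_spec.choose
  map_one' := by
    rw [mixedValue_congr (Y := Fin 0) K φ hp (H := ⊥)
      ((exists_cls_eq 1).choose_spec.choose_spec.1.trans cls_bot.symm)]
    have h1 : ∀ σ : Fin 0 → Option W, residual (⊥ : SimpleGraph (Fin 0)) σ = ⊥ :=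
      fun σ => Subsingleton.elim _ _
    have h2 : ∀ σ : Fin 0 → Option W, admissibility K (⊥ : SimpleGraph (Fin 0)) σ = 1 :=
      fun σ => if_pos fun x => x.elim0
    simp only [mixedValue, h1, h2, cls_bot, map_one, mul_one, expectation_const hp]
  map_mul' G H := by
    rw [← mixedValue_mul]
    refine mixedValue_congr K φ hp ?_
    rw [(exists_cls_eq (G * H)).choose_spec.choose_spec.1, ← cls_mul,
      (exists_cls_eq G).choose_spec.choose_spec.1, (exists_cls_eq H).choose_spec.choose_spec.1]

theorem mixture_cls (hp : ∑ v, p v = 1) (φ : UGraph →* ℝ) (G : SimpleGraph X) :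
    mixture K hp φ (cls G) = mixedValue K p φ G :=
  mixedValue_congr K φ hp (exists_cls_eq (cls G)).choose_spec.choose_spec.1

end Mixing

/-! ## Positivity of mixtures -/

section Positivity

/-- `φ` is nonnegative at the squares of combinations of graphs with at most `d` edges. -/
def IsPositiveUpTo (d : ℕ) (φ : UGraph →* ℝ) : Prop :=
  ∀ g : LabeledCombination, (∀ F ∈ g.coeff.support, F.numEdges ≤ d) →
    0 ≤ MonoidAlgebra.lift ℝ ℝ UGraph φ (unlabel (g ^ 2))

theorem IsPositiveUpTo.nonneg {d : ℕ} {φ : UGraph →* ℝ} (h : IsPositiveUpTo d φ)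
    {a : GraphCombination} (ha : IsDSos d a) : 0 ≤ MonoidAlgebra.lift ℝ ℝ UGraph φ a := by
  obtain ⟨n, f, hf, rfl⟩ := ha
  rw [map_sum]
  exact Finset.sum_nonneg fun i _ => h (f i) (hf i)

theorem lift_unlabel_sq_sum {I : Type} (S : Finset I) (A : I → PLGraph) (c : I → ℝ)
    (φ : UGraph →* ℝ) :
    MonoidAlgebra.lift ℝ ℝ UGraph φ (unlabel ((∑ i ∈ S, MonoidAlgebra.single (A i) (c i)) ^ 2))
      = ∑ i ∈ S, ∑ j ∈ S, c i * c j * φ ((A i * A j).unlabel) := by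
  rw [sq, Finset.sum_mul_sum]
  simp only [map_sum, MonoidAlgebra.single_mul_single]
  refine Finset.sum_congr rfl fun i _ => Finset.sum_congr rfl fun j _ => ?_
  have : unlabel (MonoidAlgebra.single (A i * A j) (c i * c j))
      = MonoidAlgebra.single (A i * A j).unlabel (c i * c j) := by
    simp [unlabel]
  rw [this, MonoidAlgebra.lift_single, smul_eq_mul]

variable {W : Type} [Fintype W] {m N : ℕ} (K : SimpleGraph W) {p : Option W → ℝ}

/-- Here `σ` colors the labeled vertices, and `α`, `β` color the unlabeled vertices of the two
factors. Merging doubled edges does no harm: admissibility and residual graphs turn unions of edge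
sets into products and unions. -/
theorem mixture_unlabel_mul (hp : ∑ v, p v = 1) (φ : UGraph →* ℝ)
    (G H : SimpleGraph (Fin m ⊕ Fin N)) :
    mixture K hp φ (labeledCls G * labeledCls H).unlabel
      = expectation p fun σ : Fin m → Option W =>
        expectation p fun α : Fin N → Option W => expectation p fun β : Fin N → Option W =>
          admissibility K G (Sum.elim σ α) * admissibility K H (Sum.elim σ β)
            * φ (labeledCls (residual G (Sum.elim σ α))
              * labeledCls (residual H (Sum.elim σ β))).unlabel := by
  rw [unlabel_labeledCls_mul, mixture_cls, mixedValue, expectation_sum]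
  congr 1
  funext σ
  rw [expectation_sum]
  congr 1
  funext α
  congr 1
  funext β
  have h1 : Sum.elim σ (Sum.elim α β) ∘ amalgLeft (Fin m) (Fin N) = Sum.elim σ α := by
    funext x
    rcases x with x | x <;> rfl
  have h2 : Sum.elim σ (Sum.elim α β) ∘ amalgRight (Fin m) (Fin N) = Sum.elim σ β := by
    funext x
    rcases x with x | x <;> rfl
  rw [residual_sup, admissibility_sup, residual_map, residual_map, admissibility_map,
    admissibility_map, h1, h2, unlabel_labeledCls_mul]

/-- For fixed `σ`, averaging over `α` and `β` yields `φ` of the square of one combination of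
residual graphs. Those are subgraphs of the original ones, so the bound `d` persists, and the
nonnegative weights of `σ` preserve the sign. -/
theorem IsPositiveUpTo.mixture {d : ℕ} {φ : UGraph →* ℝ} (h : IsPositiveUpTo d φ)
    (hp : ∑ v, p v = 1) (hp0 : ∀ v, 0 ≤ p v) : IsPositiveUpTo d (mixture K hp φ) := by
  classical
  intro f hf
  obtain ⟨m, hm⟩ := exists_labeledCls_eq f.coeff.support
  have hG : ∃ G : PLGraph → SimpleGraph (Fin m ⊕ Fin m),
      ∀ A ∈ f.coeff.support, labeledCls (G A) = A := by
    refine ⟨fun A => if hA : A ∈ f.coeff.support then (hm A hA).choose else ⊥, fun A hA => ?_⟩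
    simp only [hA, dif_pos]
    exact (hm A hA).choose_spec
  obtain ⟨G, hG⟩ := hG
  let w : (Fin m → Option W) → ℝ := fun σ => ∏ x, p (σ x)
  have hw : ∀ σ, 0 ≤ w σ := fun σ => Finset.prod_nonneg fun x _ => hp0 _
  let I := f.coeff.support ×ˢ (Finset.univ : Finset (Fin m → Option W))
  let A : (Fin m → Option W) → PLGraph × (Fin m → Option W) → PLGraph :=
    fun σ i => labeledCls (residual (G i.1) (Sum.elim σ i.2))
  let c : (Fin m → Option W) → PLGraph × (Fin m → Option W) → ℝ :=
    fun σ i => f.coeff i.1 * (w i.2 * admissibility K (G i.1) (Sum.elim σ i.2))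
  -- An index in `I` pairs a graph of `f` with a coloring of its unlabeled vertices; the double sum
  -- is `φ` of the square of the combination with coefficients `c σ`.
  have hpos : ∀ σ, 0 ≤ ∑ i ∈ I, ∑ j ∈ I, c σ i * c σ j * φ (A σ i * A σ j).unlabel := by
    intro σ
    rw [← lift_unlabel_sq_sum]
    refine h _ fun F hF => ?_
    rw [MonoidAlgebra.coeff_sum] at hF
    obtain ⟨i, hi, hFi⟩ := Finset.mem_biUnion.1 (Finsupp.support_finsetSum hF)
    rw [MonoidAlgebra.coeff_single] at hFi
    obtain rfl := Finset.mem_singleton.1 (Finsupp.support_single_subset hFi)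
    have hi' := (Finset.mem_product.1 hi).1
    refine le_trans ?_ (hf _ hi')
    conv_rhs => rw [← hG _ hi']
    simp only [A, numEdges_labeledCls]
    exact Set.ncard_le_ncard (SimpleGraph.edgeSet_mono (residual_le _ _)) (Set.toFinite _)
  have hexp : f = ∑ B ∈ f.coeff.support, MonoidAlgebra.single B (f.coeff B) :=
    (MonoidAlgebra.sum_coeff_single f).symm
  have key : MonoidAlgebra.lift ℝ ℝ UGraph (GluingAlgebra.mixture K hp φ) (unlabel (f ^ 2))
      = ∑ σ, w σ * ∑ i ∈ I, ∑ j ∈ I, c σ i * c σ j * φ (A σ i * A σ j).unlabel := by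
    conv_lhs => rw [hexp]
    rw [lift_unlabel_sq_sum]
    have hmix : ∀ B ∈ f.coeff.support, ∀ C ∈ f.coeff.support,
        f.coeff B * f.coeff C * GluingAlgebra.mixture K hp φ (B * C).unlabel
          = ∑ σ, w σ * ∑ α, ∑ β,
            c σ (B, α) * c σ (C, β) * φ (A σ (B, α) * A σ (C, β)).unlabel := by
      intro B hB C hC
      have := mixture_unlabel_mul K hp φ (G B) (G C)
      rw [hG B hB, hG C hC] at this
      rw [this]
      simp only [expectation_eq_sum, Finset.mul_sum]
      refine Finset.sum_congr rfl fun σ _ => Finset.sum_congr rfl fun α _ =>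
        Finset.sum_congr rfl fun β _ => ?_
      simp only [c, A, w]
      ring
    rw [Finset.sum_congr rfl fun B hB => Finset.sum_congr rfl fun C hC => hmix B hB C hC]
    simp only [I, Finset.sum_product]
    rw [Finset.sum_congr rfl fun B _ => Finset.sum_comm, Finset.sum_comm]
    refine Finset.sum_congr rfl fun σ _ => ?_
    simp only [← Finset.mul_sum]
    congr 1
    exact Finset.sum_congr rfl fun B _ => Finset.sum_comm
  rw [key]
  exact Finset.sum_nonneg fun σ _ => mul_nonneg (hw σ) (hpos σ)

end Positivity

/-! ## Homomorphism polynomials -/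

section HomPolynomial

variable {X U : Type} [Fintype X]

open Classical in
/-- The generating polynomial of the homomorphisms from `G` to `K`. -/
def homPolynomial [Fintype U] (G : SimpleGraph X) (K : SimpleGraph U) : MvPolynomial U ℝ :=
  ∑ σ : X → U, if ∀ x y, G.Adj x y → K.Adj (σ x) (σ y) then ∏ x, MvPolynomial.X (σ x) else 0

theorem prod_X_eq_monomial (σ : X → U) :
    ∏ x, (MvPolynomial.X (σ x) : MvPolynomial U ℝ)
      = MvPolynomial.monomial (∑ x, Finsupp.single (σ x) 1) 1 := by
  rw [MvPolynomial.monomial_sum_one]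
  rfl

variable [Fintype U]

theorem bijective_of_sum_single_eq {σ : X → U}
    (h : ∑ x, Finsupp.single (σ x) 1 = Finsupp.equivFunOnFinite.symm (1 : U → ℕ)) :
    Function.Bijective σ := by
  classical
  have key : ∀ u, (Finset.univ.filter fun x => σ x = u).card = 1 := by
    intro u
    have hu := DFunLike.congr_fun h u
    rw [Finsupp.finsetSum_apply] at hu
    simp only [Finsupp.single_apply] at hu
    rw [Finset.card_filter]
    exact hu
  rw [Function.bijective_iff_existsUnique]
  intro u
  obtain ⟨x, hx⟩ := Finset.card_eq_one.1 (key u)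
  refine ⟨x, (Finset.mem_filter.1 (hx ▸ Finset.mem_singleton_self x :
    x ∈ Finset.univ.filter fun x => σ x = u)).2, fun y hy => ?_⟩
  have : y ∈ Finset.univ.filter fun x => σ x = u := by simpa using hy
  rw [hx] at this
  exact Finset.mem_singleton.1 this

/-- A map contributes the monomial with all exponents `1` exactly when it hits every vertex once, so
this coefficient counts bijective homomorphisms. -/
theorem exists_bijective_of_coeff_homPolynomial_ne_zero {G : SimpleGraph X} {K : SimpleGraph U}
    (h : (homPolynomial G K).coeff (Finsupp.equivFunOnFinite.symm 1) ≠ 0) :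
    ∃ σ : X → U, Function.Bijective σ ∧ ∀ x y, G.Adj x y → K.Adj (σ x) (σ y) := by
  classical
  rw [homPolynomial, MvPolynomial.coeff_sum] at h
  obtain ⟨σ, -, hσ⟩ := Finset.exists_ne_zero_of_sum_ne_zero h
  split_ifs at hσ with hhom
  · rw [prod_X_eq_monomial, MvPolynomial.coeff_monomial] at hσ
    exact ⟨σ, bijective_of_sum_single_eq (by by_contra hne; exact hσ (if_neg hne)), hhom⟩
  · simp at hσ

theorem coeff_homPolynomial_self_pos (K : SimpleGraph U) :
    0 < (homPolynomial K K).coeff (Finsupp.equivFunOnFinite.symm 1) := by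
  classical
  rw [homPolynomial, MvPolynomial.coeff_sum]
  refine Finset.sum_pos' (fun σ _ => ?_) ⟨id, Finset.mem_univ _, ?_⟩
  · split_ifs
    · rw [prod_X_eq_monomial, MvPolynomial.coeff_monomial]
      split_ifs <;> norm_num
    · simp
  · rw [if_pos (show ∀ x y, K.Adj x y → K.Adj (id x) (id y) from fun x y h => h),
      prod_X_eq_monomial, MvPolynomial.coeff_monomial, if_pos]
    · norm_num
    · ext u
      simp [Finsupp.finsetSum_apply, Finsupp.single_apply]

theorem cls_eq_of_bijective {G : SimpleGraph X} {K : SimpleGraph U} {σ : X → U}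
    (hσ : Function.Bijective σ) (hhom : ∀ x y, G.Adj x y → K.Adj (σ x) (σ y))
    (hcard : K.edgeSet.ncard ≤ G.edgeSet.ncard) : cls G = cls K := by
  let f : X ↪ U := ⟨σ, hσ.1⟩
  have hle : G.map f ≤ K := by
    rw [SimpleGraph.map_le_iff_le_comap]
    exact fun x y h => hhom x y h
  have heq : G.map f = K := by
    rw [← SimpleGraph.edgeSet_inj]
    refine Set.eq_of_subset_of_ncard_le (SimpleGraph.edgeSet_mono hle) ?_ (Set.toFinite _)
    rw [SimpleGraph.edgeSet_map, Set.ncard_image_of_injective _ (Function.Embedding.injective _)]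
    exact hcard
  rw [← heq, cls_map]

theorem exists_eval_ne_zero {P : MvPolynomial U ℝ} (hP : P ≠ 0) :
    ∃ r : U → ℝ, (∀ u, 0 ≤ r u) ∧ ∑ u, r u ≤ 1 ∧ MvPolynomial.eval r P ≠ 0 := by
  by_contra! hcon
  have hpos : (0 : ℝ) < 1 / (Fintype.card U + 1) := by positivity
  -- A polynomial vanishing on a product of infinite sets is zero; this box is small enough to keep
  -- the total mass at most `1`, and the `+ 1` covers empty `U`.
  refine hP (MvPolynomial.funext_set (fun _ : U => Set.Ioo (0 : ℝ) (1 / (Fintype.card U + 1)))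
    (fun _ => Set.Ioo_infinite hpos) fun r hr => ?_)
  rw [map_zero]
  refine hcon r (fun u => (hr u trivial).1.le) ?_
  calc ∑ u, r u ≤ ∑ _u : U, (1 : ℝ) / (Fintype.card U + 1) :=
        Finset.sum_le_sum fun u _ => (hr u trivial).2.le
    _ = Fintype.card U / (Fintype.card U + 1) := by simp [div_eq_mul_inv]
    _ ≤ 1 := by
      rw [div_le_one (by positivity)]
      linarith

end HomPolynomial

/-! ## Mixtures along a segment of distributions -/

section Segment

variable {W : Type}

/-- The distribution with mass `1 - t` at `none` and mass `t` distributed according to `q`. -/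
def segment (q : W → ℝ) (t : ℝ) : Option W → ℝ
  | none => 1 - t
  | some w => t * q w

theorem segment_nonneg {q : W → ℝ} (hq : ∀ w, 0 ≤ q w) {t : ℝ} (h0 : 0 ≤ t) (h1 : t ≤ 1)
    (v : Option W) : 0 ≤ segment q t v := by
  rcases v with _ | w
  · exact sub_nonneg.2 h1
  · exact mul_nonneg h0 (hq w)

variable [Fintype W]

theorem sum_segment {q : W → ℝ} (hq : ∑ w, q w = 1) (t : ℝ) : ∑ v, segment q t v = 1 := by
  rw [Fintype.sum_option]
  simp only [segment, ← Finset.mul_sum, hq]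
  ring

variable (K : SimpleGraph W) {q : W → ℝ} (hq : ∑ w, q w = 1) (φ : UGraph →* ℝ)

theorem exists_polynomial_mixture_apply (H : UGraph) :
    ∃ P : Polynomial ℝ, ∀ t, mixture K (sum_segment hq t) φ H = P.eval t := by
  obtain ⟨n, G, rfl, -⟩ := exists_cls_eq H
  let s : Option W → Polynomial ℝ := fun v =>
    v.elim (1 - Polynomial.X) fun w => Polynomial.X * Polynomial.C (q w)
  have hs : ∀ v t, (s v).eval t = segment q t v := by
    rintro (_ | w) t
    · simp [s, segment]
    · simpa [s, segment] using mul_comm _ _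
  refine ⟨∑ σ : Fin n → Option W, (∏ x, s (σ x))
    * Polynomial.C (admissibility K G σ * φ (cls (residual G σ))), fun t => ?_⟩
  rw [mixture_cls, mixedValue, expectation_eq_sum]
  simp only [Polynomial.eval_finsetSum, Polynomial.eval_mul, Polynomial.eval_prod,
    Polynomial.eval_C, hs]

theorem exists_polynomial_lift_mixture (a : GraphCombination) :
    ∃ P : Polynomial ℝ, ∀ t,
      MonoidAlgebra.lift ℝ ℝ UGraph (mixture K (sum_segment hq t) φ) a = P.eval t := by
  choose P hP using exists_polynomial_mixture_apply K hq φ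
  refine ⟨∑ H ∈ a.coeff.support, Polynomial.C (a.coeff H) * P H, fun t => ?_⟩
  rw [MonoidAlgebra.lift_apply, Finsupp.sum]
  simp only [Polynomial.eval_finsetSum, Polynomial.eval_mul, Polynomial.eval_C, hP, smul_eq_mul]

theorem mixture_segment_zero : mixture K (sum_segment hq 0) φ = φ := by
  ext H
  obtain ⟨n, G, rfl, -⟩ := exists_cls_eq H
  -- At `t = 0` every color other than `none` has weight `0`.
  rw [mixture_cls, mixedValue, expectation_eq_sum, Finset.sum_eq_single fun _ => none]
  · have h1 : residual G (fun _ => (none : Option W)) = G := by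
      ext x y
      simp [residual]
    have h2 : admissibility K G (fun _ => none) = 1 := if_pos fun x y _ => Or.inl ⟨rfl, rfl⟩
    rw [h1, h2]
    simp [segment]
  · intro σ _ hσ
    obtain ⟨x, hx⟩ := Function.ne_iff.1 hσ
    obtain ⟨w, hw⟩ := Option.ne_none_iff_exists'.1 hx
    rw [Finset.prod_eq_zero (Finset.mem_univ x) (by simp [hw, segment]), zero_mul]
  · simp

end Segment

/-! ### Homomorphism densities that do not vanish at a given combination -/

section Density

variable {X U : Type} [Fintype X] [Fintype U]

/-- Completing a subdistribution to a distribution. -/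
def completion (r : U → ℝ) : Option U → ℝ
  | none => 1 - ∑ u, r u
  | some u => r u

theorem sum_completion (r : U → ℝ) : ∑ v, completion r v = 1 := by
  rw [Fintype.sum_option]
  simp [completion]

theorem completion_nonneg {r : U → ℝ} (hr : ∀ u, 0 ≤ r u) (hr1 : ∑ u, r u ≤ 1) (v : Option U) :
    0 ≤ completion r v := by
  rcases v with _ | u
  · exact sub_nonneg.2 hr1
  · exact hr u

/-- Neither extra color contributes: the outer `none` has weight `0` at `t = 1`, and `some none`,
which absorbs the missing mass of `r`, is isolated in the target while every vertex of `G` has a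
neighbor. -/
theorem mixture_segment_one_cls (K : SimpleGraph U) (r : U → ℝ) (φ : UGraph →* ℝ)
    {G : SimpleGraph X} (hG : ∀ x, ∃ y, G.Adj x y) :
    mixture (K.map (some : U → Option U)) (sum_segment (sum_completion r) 1) φ (cls G)
      = MvPolynomial.eval r (homPolynomial G K) := by
  classical
  rw [mixture_cls, mixedValue, expectation_eq_sum, homPolynomial, map_sum]
  symm
  refine Fintype.sum_of_injective (fun (σ : X → U) x => some (some (σ x))) ?_ _ _ ?_ ?_
  · intro σ τ h
    funext x
    simpa using congrFun h x
  · intro σ hσ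
    by_contra hne
    refine hσ ?_
    have hadm : IsAdmissible (K.map (some : U → Option U)) G σ := by
      by_contra hn
      exact hne (by simp [admissibility, hn])
    have hsome : ∀ x, ∃ u, σ x = some (some u) := by
      intro x
      obtain ⟨y, hxy⟩ := hG x
      rcases hadm x y hxy with ⟨h, -⟩ | ⟨a, b, h, -, hab⟩
      · exact absurd (by rw [Finset.prod_eq_zero (Finset.mem_univ x) (by simp [h, segment]),
          zero_mul]) hne
      · obtain ⟨u, -, -, rfl, -⟩ :=
          (SimpleGraph.map_adj (Function.Embedding.some : U ↪ Option U) _ _ _).1 hab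
        exact ⟨u, h⟩
    choose τ hτ using hsome
    exact ⟨τ, funext fun x => (hτ x).symm⟩
  · intro σ
    have h1 : residual G (fun x => some (some (σ x))) = ⊥ := by
      ext x y
      simp [residual]
    have h2 : IsAdmissible (K.map (some : U → Option U)) G (fun x => some (some (σ x)))
        ↔ ∀ x y, G.Adj x y → K.Adj (σ x) (σ y) := by
      have : ∀ u v, (K.map (some : U → Option U)).Adj (some u) (some v) ↔ K.Adj u v :=
        fun u v => SimpleGraph.map_adj_apply (f := (Function.Embedding.some : U ↪ Option U))
      simp [IsAdmissible, this]
    simp only [h1, admissibility, h2, cls_bot, map_one, mul_one]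
    split_ifs
    · simp [segment, completion]
    · simp

theorem exists_lift_mixture_ne_zero {b : GraphCombination} (hb : b ≠ 0) (φ : UGraph →* ℝ) :
    ∃ (n : ℕ) (K : SimpleGraph (Option (Fin n))) (q : Option (Fin n) → ℝ)
      (hq : ∑ w, q w = 1), (∀ w, 0 ≤ q w) ∧
        MonoidAlgebra.lift ℝ ℝ UGraph (mixture K (sum_segment hq 1) φ) b ≠ 0 := by
  classical
  choose n G hG hG' using exists_cls_eq
  have hne : b.coeff.support.Nonempty := by
    rw [Finsupp.support_nonempty_iff]
    simpa using hb
  obtain ⟨H₀, hH₀, hmax⟩ := Finset.exists_max_image _ n hne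
  -- `H₁` has the fewest edges among the constituents on its number of vertices. A bijective
  -- homomorphism from another constituent to it would then be an isomorphism, so only `H₁`
  -- contributes to the multilinear coefficient of `P`.
  obtain ⟨H₁, hH₁, hmin⟩ := Finset.exists_min_image (b.coeff.support.filter fun H => n H = n H₀)
    (fun H => (G H).edgeSet.ncard) ⟨H₀, by simp only [Finset.mem_filter, hH₀, and_self]⟩
  rw [Finset.mem_filter] at hH₁
  let P : MvPolynomial (Fin (n H₁)) ℝ :=
    ∑ H ∈ b.coeff.support, MvPolynomial.C (b.coeff H) * homPolynomial (G H) (G H₁)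
  have hP : P ≠ 0 := by
    intro h0
    have hcoeff := congrArg (MvPolynomial.coeff (Finsupp.equivFunOnFinite.symm 1)) h0
    simp only [P, MvPolynomial.coeff_sum, MvPolynomial.coeff_C_mul, MvPolynomial.coeff_zero]
      at hcoeff
    rw [Finset.sum_eq_single H₁] at hcoeff
    · exact mul_ne_zero (Finsupp.mem_support_iff.1 hH₁.1)
        (coeff_homPolynomial_self_pos (G H₁)).ne' hcoeff
    · intro H hH hne
      by_contra hc
      obtain ⟨σ, hσ, hhom⟩ :=
        exists_bijective_of_coeff_homPolynomial_ne_zero (right_ne_zero_of_mul hc)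
      have hcard : n H = n H₁ := by simpa using Fintype.card_of_bijective hσ
      have := cls_eq_of_bijective hσ hhom
        (hmin H (Finset.mem_filter.2 ⟨hH, hcard.trans hH₁.2⟩))
      rw [hG, hG] at this
      exact hne this
    · exact fun h => absurd hH₁.1 h
  obtain ⟨r, hr, hr1, heval⟩ := exists_eval_ne_zero hP
  refine ⟨n H₁, (G H₁).map some, completion r, sum_completion r, completion_nonneg hr hr1, ?_⟩
  convert heval using 1
  rw [MonoidAlgebra.lift_apply, Finsupp.sum]
  simp only [P, map_sum, map_mul, MvPolynomial.eval_C, smul_eq_mul]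
  refine Finset.sum_congr rfl fun H _ => ?_
  rw [← mixture_segment_one_cls (G H₁) r φ (hG' H), hG]

end Density

/-! ## Sums of squares -/

/-- Stated for all large `d`, so that one `d` serves both `b` and `c`. -/
theorem IsSos.exists_isDSos {a : GraphCombination} (h : IsSos a) :
    ∃ d₀, ∀ d ≥ d₀, IsDSos d a := by
  obtain ⟨n, f, rfl⟩ := h
  refine ⟨Finset.univ.sup fun i => (f i).coeff.support.sup LGraph.numEdges,
    fun d hd => ⟨n, f, fun i F hF => le_trans ?_ hd, rfl⟩⟩
  exact (Finset.le_sup (f := LGraph.numEdges) hF).trans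
    (Finset.le_sup (f := fun i => (f i).coeff.support.sup LGraph.numEdges) (Finset.mem_univ i))

theorem isPositiveUpTo_of_mem_sosProfile {d : ℕ} {v : profileGraphs d → ℝ}
    (hv : v ∈ sosProfile d) :
    IsPositiveUpTo d (multiplicativeExtension (Function.extend Subtype.val v 0)) := by
  intro g hg
  rw [← evalAt_eq_lift]
  exact hv.2 _ ⟨1, fun _ => g, fun _ => hg, by simp⟩

theorem hasComponentsIn_of_numEdges_le {d : ℕ} {a : GraphCombination}
    (h : ∀ H ∈ a.coeff.support, H.numEdges ≤ d) : HasComponentsIn d a :=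
  fun H hH _ hC => mem_profileGraphs_of_mem_components hC (h H hH)

theorem IsPositiveUpTo.lift_nonneg_of_mul_eq {d : ℕ} {φ : UGraph →* ℝ} (h : IsPositiveUpTo d φ)
    {a b c : GraphCombination} (hb0 : b ≠ 0) (hb : IsDSos d b) (hc : IsDSos d c)
    (habc : a * b = c) : 0 ≤ MonoidAlgebra.lift ℝ ℝ UGraph φ a := by
  obtain ⟨n, K, q, hq, hq0, hne⟩ := exists_lift_mixture_ne_zero hb0 φ
  obtain ⟨P, hP⟩ := exists_polynomial_lift_mixture K hq φ a
  obtain ⟨Q, hQ⟩ := exists_polynomial_lift_mixture K hq φ b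
  have hQ0 : Q ≠ 0 := by
    rintro rfl
    exact hne (by rw [hQ, Polynomial.eval_zero])
  rw [← mixture_segment_zero K hq φ, hP]
  by_contra! hneg
  obtain ⟨δ, hδ, hball⟩ := Metric.eventually_nhds_iff.1
    (P.continuous.continuousAt.eventually_lt_const hneg)
  -- If `P < 0` near `0`, then `Q ≥ 0` and `P * Q ≥ 0` force `Q` to vanish on a whole interval. The
  -- cap `1` keeps the color weights nonnegative.
  have hroot : ∀ t ∈ Set.Ioo 0 (min δ 1), Q.IsRoot t := by
    intro t ht
    have ht1 := lt_min_iff.1 ht.2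
    have hPt : P.eval t < 0 := hball (by
      rw [Real.dist_eq, sub_zero, abs_of_pos ht.1]
      exact ht1.1)
    have hpos := h.mixture K (sum_segment hq t) (segment_nonneg hq0 ht.1.le ht1.2.le)
    have hQt : 0 ≤ Q.eval t := hQ t ▸ hpos.nonneg hb
    have hPQ : 0 ≤ P.eval t * Q.eval t := by
      rw [← hP, ← hQ, ← map_mul, habc]
      exact hpos.nonneg hc
    by_contra hr
    have : 0 < Q.eval t := lt_of_le_of_ne hQt (Ne.symm hr)
    nlinarith
  exact hQ0 (Polynomial.eq_zero_of_infinite_isRoot Q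
    ((Set.Ioo_infinite (lt_min hδ one_pos)).mono hroot))

end GluingAlgebra

end

theorem corollary4 (a : GluingAlgebra.GraphCombination)
    (ha : ¬ GluingAlgebra.IsSosTestable a) : ¬ GluingAlgebra.IsRationalSos a := by
  rintro ⟨b, c, hb0, hb, hc, habc⟩
  obtain ⟨d₁, hd₁⟩ := hb.exists_isDSos
  obtain ⟨d₂, hd₂⟩ := hc.exists_isDSos
  -- The sum dominates all three bounds at once, and `+ 1` makes `d` positive.
  let d := a.coeff.support.sup GluingAlgebra.LGraph.numEdges + d₁ + d₂ + 1
  refine ha ⟨d, Nat.succ_pos _,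
    GluingAlgebra.hasComponentsIn_of_numEdges_le fun H hH => ?_, fun v hv => ?_⟩
  · have := Finset.le_sup (f := GluingAlgebra.LGraph.numEdges) hH
    omega
  · rw [GluingAlgebra.evalAt_eq_lift]
    exact (GluingAlgebra.isPositiveUpTo_of_mem_sosProfile hv).lift_nonneg_of_mul_eq hb0
      (hd₁ d (by omega)) (hd₂ d (by omega)) habc
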